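/- Let $\mathbb{B}$ be the Bargmann space of entire functions $\phi$ with $\|\phi\|^2=\frac1\pi\int_{\mathbb{C}}|\phi(z)|^2e^{-|z|^2}\,dx\,dy<\infty$, with orthonormal basis $e_k(z)=z^k/\sqrt{k!}$, $k\ge 0$. Let $p\ge 0$ and $m\ge 1$ be integers with $p+\frac m2>1$ (so all $p,m\ge 1$ are allowed), let $\mathbb{B}_p$ be the closed subspace of $\mathbb{B}$ generated by the $e_k$ with $k\ge p$, and put $$\omega_k=\omega_k^{p,m}=\frac{\sqrt{k!\,(k+m)!}}{(k-p)!}\qquad(k\ge p).$$ Let $\breve{\mathbb{H}}$ be the weighted shift on $\mathbb{B}_p$ given by $\breve{\mathbb{H}}e_p=0$, $\breve{\mathbb{H}}e_k=\omega_{k-1}e_{k-1}$ for $k>p$, that is $\breve{\mathbb{H}}\sum_{k\ge p}a_ke_k=\sum_{k\ge p}\omega_ka_{k+1}e_k$, with domain $\{\phi\in\mathbb{B}_p : \breve{\mathbb{H}}\phi\in\mathbb{B}_p\}$, and let $\breve{\mathbb{H}}^*$ be its adjoint, for which $\breve{\mathbb{H}}^*e_k=\omega_ke_{k+1}$ $(k\ge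 p)$. The sum $\breve{\mathbb{H}}+\breve{\mathbb{H}}^*$ is taken with its maximal domain: it is the operator $$\sum_{k\ge p}a_ke_k\longmapsto\sum_{k\ge p}(\omega_ka_{k+1}+\omega_{k-1}a_{k-1})e_k\qquad(\text{with }\omega_{p-1}a_{p-1}:=0)$$ whose domain consists of all $\phi=\sum_{k\ge p}a_ke_k\in\mathbb{B}_p$ for which the right-hand side lies in $\mathbb{B}_p$. Theorem 3.8. This operator extends the operator sum of $\breve{\mathbb{H}}$ and its Hilbert space adjoint $\breve{\mathbb{H}}^*$ on $D(\breve{\mathbb{H}})\cap D(\breve{\mathbb{H}}^*)$, and it is chaotic on $\mathbb{B}_p$. Here a densely defined unbounded linear operator $\mathbb{T}$ on a Banach space $\mathbb{X}$ is called chaotic if 1. $\mathbb{T}^n$ is closed for every integer $n\ge 1$; 2. there is $\phi\in\bigcap_{n\ge1}D(\mathbb{T}^n)$ whose orbit $\{\phi,\mathbb{T}\phi,\mathbb{T}^2\phi,\dots\}$ is dense in $\mathbb{X}$; 3. the set of periodic points $\{\phi : \mathbb{T}^j\phi=\phi\text{ for some integer }j\ge 1\}$ is dense in $\mathbb{X}$.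 -/

import Mathlib

open MeasureTheory Filter Topology
open scoped ENNReal LinearPMap InnerProductSpace

namespace HeunBargmann

/-! ### The Bargmann space -/

/-- The Gaussian probability measure `π⁻¹ exp(-|z|²) dx dy` on `ℂ`; the factor `π⁻¹` is the
normalization for which the functions `z ^ k / √(k!)` are orthonormal. -/
noncomputable def gaussian : Measure ℂ :=
  volume.withDensity fun z => ENNReal.ofReal (Real.pi⁻¹ * Real.exp (-‖z‖ ^ 2))

/-- The Bargmann space: the (classes of) entire functions that are square integrable with respect
to the Gaussian measure, with the inner product of `L²`. -/
noncomputable def bargmann : Submodule ℂ (Lp ℂ 2 gaussian) where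
  carrier := {f | ∃ φ : ℂ → ℂ, Differentiable ℂ φ ∧ f =ᵐ[gaussian] φ}
  add_mem' := by
    rintro f g ⟨φ, hφ, hf⟩ ⟨ψ, hψ, hg⟩
    exact ⟨φ + ψ, hφ.add hψ, (Lp.coeFn_add f g).trans (hf.add hg)⟩
  zero_mem' := ⟨0, differentiable_const 0, Lp.coeFn_zero ℂ 2 gaussian⟩
  smul_mem' := by
    rintro c f ⟨φ, hφ, hf⟩
    exact ⟨c • φ, hφ.const_smul c, (Lp.coeFn_smul c f).trans (hf.const_smul c)⟩

/-- The function `e_k(z) = z ^ k / √(k!)`. -/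
noncomputable def monomialFun (k : ℕ) (z : ℂ) : ℂ := z ^ k / (√(k.factorial : ℝ) : ℂ)

theorem differentiable_monomialFun (k : ℕ) : Differentiable ℂ (monomialFun k) := by
  unfold monomialFun
  fun_prop

theorem memLp_monomialFun (k : ℕ) : MemLp (monomialFun k) 2 gaussian := by
  have hm : AEStronglyMeasurable (monomialFun k) gaussian :=
    (differentiable_monomialFun k).continuous.aestronglyMeasurable
  rw [memLp_two_iff_integrable_sq_norm hm]
  unfold gaussian
  rw [integrable_withDensity_iff (by fun_prop) (by simp)]
  have h1 := Complex.integral_rpow_mul_exp_neg_rpow (p := 2) (q := (2 * k : ℕ)) (by norm_num)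
    (by have : (0 : ℝ) ≤ ((2 * k : ℕ) : ℝ) := by positivity
        linarith)
  have h2 : Integrable (fun x : ℂ => ‖x‖ ^ ((2 * k : ℕ) : ℝ) * Real.exp (-‖x‖ ^ (2 : ℝ))) := by
    apply Integrable.of_integral_ne_zero
    rw [h1]
    have : 0 < Real.Gamma ((((2 * k : ℕ) : ℝ) + 2) / 2) := Real.Gamma_pos_of_pos (by positivity)
    positivity
  have h3 := h2.const_mul ((k.factorial : ℝ)⁻¹ * Real.pi⁻¹)
  refine h3.congr (Eventually.of_forall fun z => ?_)
  have hk : (0 : ℝ) < k.factorial := by positivity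
  simp only [monomialFun, norm_div, norm_pow, Complex.norm_real, Real.rpow_natCast]
  rw [ENNReal.toReal_ofReal (by positivity), div_pow, Real.norm_of_nonneg (Real.sqrt_nonneg _),
    Real.sq_sqrt hk.le, Real.rpow_two]
  field_simp
  ring

/-- `e_k` as an element of `L²`. -/
noncomputable def e (k : ℕ) : Lp ℂ 2 gaussian := (memLp_monomialFun k).toLp _

theorem e_mem_bargmann (k : ℕ) : e k ∈ bargmann :=
  ⟨monomialFun k, differentiable_monomialFun k, (memLp_monomialFun k).coeFn_toLp⟩

/-! ### The subspaces generated by `e_p, e_{p+1}, …` -/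

/-- `B_p`, the closed subspace of the Bargmann space generated by the `e_k` with `k ≥ p`
(the closure in the Bargmann space of their linear span). -/
noncomputable def bargmannSub (p : ℕ) : Submodule ℂ (Lp ℂ 2 gaussian) :=
  bargmann ⊓ (Submodule.span ℂ (e '' Set.Ici p)).topologicalClosure

theorem e_mem_bargmannSub (p n : ℕ) : e (p + n) ∈ bargmannSub p :=
  ⟨e_mem_bargmann _, Submodule.le_topologicalClosure _
    (Submodule.subset_span ⟨p + n, Set.mem_Ici.2 (Nat.le_add_right p n), rfl⟩)⟩

/-- The `n`-th basis vector `e_{p+n}` of `B_p`. -/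
noncomputable def b (p n : ℕ) : bargmannSub p := ⟨e (p + n), e_mem_bargmannSub p n⟩

/-! ### Completeness -/

/-- A local area bound for entire functions, from the mean value property on circles. -/
theorem enorm_mul_pi_le {φ : ℂ → ℂ} (hφ : Differentiable ℂ φ) (w : ℂ) :
    ‖φ w‖ₑ * ENNReal.ofReal Real.pi ≤ ∫⁻ z in Metric.ball w 1, ‖φ z‖ₑ := by
  have hc := hφ.continuous
  have hcirc : ∀ r : ℝ, ‖φ w‖ₑ * ENNReal.ofReal (2 * Real.pi) ≤
      ∫⁻ θ in Set.Ioo (-Real.pi) Real.pi, ‖φ (w + Complex.polarCoord.symm (r, θ))‖ₑ := by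
    intro r
    have h1 : Real.circleAverage φ w r = φ w :=
      (hφ.diffContOnCl).circleAverage
    have h2 : (∫ θ in (0 : ℝ)..(2 * Real.pi), φ (circleMap w r θ)) = (2 * Real.pi) • φ w := by
      rw [← h1, Real.circleAverage, smul_smul, mul_inv_cancel₀ (by positivity), one_smul]
    have hper : Function.Periodic (fun θ => φ (circleMap w r θ)) (2 * Real.pi) := fun θ => by
      simp only [periodic_circleMap w r θ]
    have h3 := hper.intervalIntegral_add_eq 0 (-Real.pi)
    rw [zero_add, h2, show -Real.pi + 2 * Real.pi = Real.pi by ring,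
      intervalIntegral.integral_of_le (by linarith [Real.pi_pos]),
      integral_Ioc_eq_integral_Ioo] at h3
    calc ‖φ w‖ₑ * ENNReal.ofReal (2 * Real.pi) = ‖(2 * Real.pi) • φ w‖ₑ := by
          rw [enorm_smul, mul_comm, Real.enorm_of_nonneg (by positivity)]
      _ ≤ ∫⁻ θ in Set.Ioo (-Real.pi) Real.pi, ‖φ (circleMap w r θ)‖ₑ := by
          rw [h3]; exact enorm_integral_le_lintegral_enorm _
      _ = _ := by
          refine lintegral_congr fun θ => ?_
          congr 2
          rw [Complex.polarCoord_symm_apply, circleMap, Complex.exp_mul_I]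
          simp
  have hpol : ∫⁻ z in Metric.ball w 1, ‖φ z‖ₑ =
      ∫⁻ p in polarCoord.target, ENNReal.ofReal p.1 •
        (Metric.ball (0 : ℂ) 1).indicator (fun z => ‖φ (w + z)‖ₑ) (Complex.polarCoord.symm p) := by
    rw [Complex.lintegral_comp_polarCoord_symm, ← lintegral_indicator Metric.isOpen_ball.measurableSet,
      ← lintegral_add_left_eq_self _ w]
    refine lintegral_congr fun z => ?_
    by_cases hz : z ∈ Metric.ball (0 : ℂ) 1
    · rw [Set.indicator_of_mem hz, Set.indicator_of_mem]
      simpa using hz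
    · rw [Set.indicator_of_notMem hz, Set.indicator_of_notMem]
      simpa using hz
  rw [hpol]
  have hsub : Set.Ioo (0 : ℝ) 1 ×ˢ Set.Ioo (-Real.pi) Real.pi ⊆ polarCoord.target := by
    rintro ⟨r, θ⟩ ⟨hr, hθ⟩
    exact ⟨hr.1, hθ⟩
  have hmeas : Measurable fun p : ℝ × ℝ =>
      ENNReal.ofReal p.1 * ‖φ (w + Complex.polarCoord.symm p)‖ₑ := by
    have : Measurable fun p : ℝ × ℝ => Complex.polarCoord.symm p := by
      simp only [Complex.polarCoord_symm_apply]
      fun_prop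
    have h2 : Measurable φ := hc.measurable
    fun_prop
  have hr : ∫⁻ r in Set.Ioo (0 : ℝ) 1, ENNReal.ofReal r = ENNReal.ofReal (1 / 2) := by
    rw [← ofReal_integral_eq_lintegral_ofReal]
    · rw [← integral_Ioc_eq_integral_Ioo, ← intervalIntegral.integral_of_le zero_le_one,
        integral_id]
      norm_num
    · exact (continuous_id.integrableOn_Icc (a := 0) (b := 1)).mono_set Set.Ioo_subset_Icc_self
    · exact (ae_restrict_mem measurableSet_Ioo).mono fun r hr => hr.1.le
  calc ‖φ w‖ₑ * ENNReal.ofReal Real.pi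
      = ∫⁻ r in Set.Ioo (0 : ℝ) 1,
          ENNReal.ofReal r * (‖φ w‖ₑ * ENNReal.ofReal (2 * Real.pi)) := by
        rw [lintegral_mul_const _ (by fun_prop), hr, mul_left_comm,
          ← ENNReal.ofReal_mul (by norm_num)]
        congr 2
        ring
    _ ≤ ∫⁻ r in Set.Ioo (0 : ℝ) 1, ∫⁻ θ in Set.Ioo (-Real.pi) Real.pi,
          ENNReal.ofReal r * ‖φ (w + Complex.polarCoord.symm (r, θ))‖ₑ := by
        refine lintegral_mono fun r => ?_
        rw [lintegral_const_mul' _ _ ENNReal.ofReal_ne_top]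
        gcongr
        exact hcirc r
    _ = ∫⁻ p in Set.Ioo (0 : ℝ) 1 ×ˢ Set.Ioo (-Real.pi) Real.pi,
          ENNReal.ofReal p.1 * ‖φ (w + Complex.polarCoord.symm p)‖ₑ := by
        rw [Measure.volume_eq_prod, ← Measure.prod_restrict,
          lintegral_prod _ hmeas.aemeasurable]
    _ = ∫⁻ p in Set.Ioo (0 : ℝ) 1 ×ˢ Set.Ioo (-Real.pi) Real.pi, ENNReal.ofReal p.1 •
        (Metric.ball (0 : ℂ) 1).indicator (fun z => ‖φ (w + z)‖ₑ)
          (Complex.polarCoord.symm p) := by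
        refine setLIntegral_congr_fun (measurableSet_Ioo.prod measurableSet_Ioo) fun p hp => ?_
        have : Complex.polarCoord.symm p ∈ Metric.ball (0 : ℂ) 1 := by
          rw [mem_ball_zero_iff, Complex.norm_polarCoord_symm, abs_of_pos hp.1.1]
          exact hp.1.2
        simp only [Set.indicator_of_mem this, smul_eq_mul]
    _ ≤ _ := lintegral_mono_set hsub

instance : IsFiniteMeasure gaussian := by
  have h := (memLp_two_iff_integrable_sq_norm
    (differentiable_monomialFun 0).continuous.aestronglyMeasurable).1 (memLp_monomialFun 0)
  have h2 : Integrable (fun _ : ℂ => (1 : ℝ)) gaussian := by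
    simpa [monomialFun] using h
  exact (integrable_const_iff_isFiniteMeasure one_ne_zero).1 h2

theorem volume_absolutelyContinuous : (volume : Measure ℂ) ≪ gaussian :=
  withDensity_absolutelyContinuous' (by fun_prop) (Eventually.of_forall fun z => by
    have := Real.pi_pos
    have := Real.exp_pos (-‖z‖ ^ 2)
    simp only [ne_eq, ENNReal.ofReal_eq_zero, not_le]
    positivity)

/-- Point evaluations are locally uniformly bounded by the `L²` norm. -/
theorem exists_bound (R : ℝ) : ∃ C : ℝ, 0 ≤ C ∧ ∀ (f : Lp ℂ 2 gaussian) (φ : ℂ → ℂ),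
    Differentiable ℂ φ → f =ᵐ[gaussian] φ → ∀ w, ‖w‖ ≤ R → ‖φ w‖ ≤ C * ‖f‖ := by
  have hpi := Real.pi_pos
  set d : ℝ≥0∞ := ENNReal.ofReal (Real.pi⁻¹ * Real.exp (-(R + 1) ^ 2)) with hd
  have hd0 : d ≠ 0 := by
    have := Real.exp_pos (-(R + 1) ^ 2)
    simp only [hd, ne_eq, ENNReal.ofReal_eq_zero, not_le]
    positivity
  set G : ℝ≥0∞ := gaussian Set.univ ^ (1 / (2 : ℝ)) with hG
  have hG1 : G ≠ ∞ := ENNReal.rpow_ne_top_of_nonneg (by norm_num) (measure_ne_top _ _)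
  set K : ℝ≥0∞ := (ENNReal.ofReal Real.pi)⁻¹ * d⁻¹ * G with hK
  have hpi0 : ENNReal.ofReal Real.pi ≠ 0 := by simpa using hpi
  have hK1 : K ≠ ∞ :=
    ENNReal.mul_ne_top (ENNReal.mul_ne_top (ENNReal.inv_ne_top.2 hpi0)
      (ENNReal.inv_ne_top.2 hd0)) hG1
  refine ⟨K.toReal, ENNReal.toReal_nonneg, fun f φ hφ hf w hw => ?_⟩
  have h1 := enorm_mul_pi_le hφ w
  have h2 : d * ∫⁻ z in Metric.ball w 1, ‖φ z‖ₑ ≤ ∫⁻ z, ‖φ z‖ₑ ∂gaussian := by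
    rw [gaussian, lintegral_withDensity_eq_lintegral_mul _ (by fun_prop)
      hφ.continuous.measurable.enorm, ← lintegral_const_mul' _ _ ENNReal.ofReal_ne_top]
    refine le_trans ?_ (setLIntegral_le_lintegral (Metric.ball w 1) _)
    refine setLIntegral_mono' Metric.isOpen_ball.measurableSet fun z hz => ?_
    simp only [Pi.mul_apply]
    gcongr
    have hz1 : ‖z - w‖ < 1 := by simpa [dist_eq_norm] using hz
    have : ‖z‖ ≤ ‖z - w‖ + ‖w‖ := by simpa using norm_add_le (z - w) w
    linarith
  have h3 : ∫⁻ z, ‖φ z‖ₑ ∂gaussian ≤ ‖f‖ₑ * G := by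
    rw [← eLpNorm_one_eq_lintegral_enorm, ← eLpNorm_congr_ae hf, Lp.enorm_def]
    have := eLpNorm_le_eLpNorm_mul_rpow_measure_univ (p := 1) (q := 2) (μ := gaussian)
      (by norm_num) (Lp.aestronglyMeasurable f)
    refine this.trans (le_of_eq ?_)
    rw [hG]
    congr 2
    norm_num
  have h4 : ‖φ w‖ₑ ≤ K * ‖f‖ₑ := by
    have hdt : d ≠ ∞ := ENNReal.ofReal_ne_top
    have e1 : ∫⁻ z in Metric.ball w 1, ‖φ z‖ₑ ≤ d⁻¹ * (‖f‖ₑ * G) := by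
      rw [← ENNReal.mul_le_iff_le_inv hd0 hdt]
      exact h2.trans h3
    have e2 := h1.trans e1
    rw [mul_comm, ENNReal.mul_le_iff_le_inv hpi0 ENNReal.ofReal_ne_top] at e2
    refine e2.trans (le_of_eq ?_)
    rw [hK]
    ring
  have h5 := ENNReal.toReal_mono (ENNReal.mul_ne_top hK1 enorm_ne_top) h4
  simpa [ENNReal.toReal_mul] using h5

theorem isClosed_bargmann : IsClosed (bargmann : Set (Lp ℂ 2 gaussian)) := by
  rw [← isSeqClosed_iff_isClosed]
  intro f g hf hfg
  choose φ hφ hfφ using hf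
  have hcau : ∀ R : ℝ, UniformCauchySeqOn φ atTop (Metric.ball 0 R) := by
    intro R
    obtain ⟨C, hC, hb⟩ := exists_bound R
    rw [Metric.uniformCauchySeqOn_iff]
    intro ε hε
    obtain ⟨N, hN⟩ := Metric.cauchySeq_iff.1 hfg.cauchySeq (ε / (C + 1)) (by positivity)
    refine ⟨N, fun m hm n hn w hw => ?_⟩
    have h1 := hb (f m - f n) (φ m - φ n) ((hφ m).sub (hφ n))
      ((Lp.coeFn_sub _ _).trans ((hfφ m).sub (hfφ n))) w (mem_ball_zero_iff.1 hw).le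
    have h2 := hN m hm n hn
    rw [dist_eq_norm] at h2 ⊢
    refine lt_of_le_of_lt (by simpa using h1) ?_
    rw [lt_div_iff₀ (by positivity)] at h2
    nlinarith [norm_nonneg (f m - f n)]
  have hlim : ∀ w, ∃ l, Tendsto (fun n => φ n w) atTop (𝓝 l) := fun w =>
    cauchySeq_tendsto_of_complete
      ((hcau (‖w‖ + 1)).cauchySeq (mem_ball_zero_iff.2 (by linarith)))
  choose ψ hψ using hlim
  have hunif : ∀ R : ℝ, TendstoUniformlyOn φ ψ atTop (Metric.ball 0 R) := fun R =>
    (hcau R).tendstoUniformlyOn_of_tendsto fun w _ => hψ w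
  have hdiff : Differentiable ℂ ψ := by
    intro w
    have h := ((hunif (‖w‖ + 1)).tendstoLocallyUniformlyOn).differentiableOn
      (Eventually.of_forall fun n => (hφ n).differentiableOn) Metric.isOpen_ball
    exact h.differentiableAt (Metric.isOpen_ball.mem_nhds (mem_ball_zero_iff.2 (by linarith)))
  refine ⟨ψ, hdiff, ?_⟩
  obtain ⟨ns, hns, hae⟩ := (tendstoInMeasure_of_tendsto_Lp hfg).exists_seq_tendsto_ae
  have hall : ∀ᵐ z ∂gaussian, ∀ n, f n z = φ n z := ae_all_iff.2 hfφ
  filter_upwards [hae, hall] with z hz hz'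
  simp only [hz'] at hz
  exact tendsto_nhds_unique hz ((hψ z).comp hns.tendsto_atTop)

instance (p : ℕ) : CompleteSpace (bargmannSub p) :=
  (isClosed_bargmann.inter (Submodule.isClosed_topologicalClosure _)).completeSpace_coe

/-! ### Unbounded operators -/

section Operators

variable {E : Type*} [NormedAddCommGroup E] [InnerProductSpace ℂ E]

/-- Unbounded operators in `E`: linear maps from a subspace of `E` to `E`. -/
abbrev Op (E : Type*) [NormedAddCommGroup E] [InnerProductSpace ℂ E] := E →ₗ.[ℂ] E

/-- The sequence of coefficients `a_n = ⟨v_n, φ⟩` of `φ` with respect to a sequence of vectors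
(the inner product is linear in the second variable). -/
noncomputable def coeff (v : ℕ → E) : E →ₗ[ℂ] (ℕ → ℂ) where
  toFun x n := ⟪v n, x⟫_ℂ
  map_add' x y := by ext n; exact inner_add_right _ _ _
  map_smul' c x := by ext n; exact inner_smul_right _ _ _

/-- The pairs `(x, y)` with `y = M x` coefficientwise. -/
noncomputable def maximalGraph (v : ℕ → E) (M : (ℕ → ℂ) →ₗ[ℂ] (ℕ → ℂ)) :
    Submodule ℂ (E × E) :=
  LinearMap.eqLocus (coeff v ∘ₗ LinearMap.snd ℂ E E) (M ∘ₗ coeff v ∘ₗ LinearMap.fst ℂ E E)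

/-- The operator given by the expression `M` on coefficient sequences, with its maximal domain
`{x ∈ E | M x ∈ E}`. Here `v` has to be total, so that `y = M x` determines `y`. -/
noncomputable def maximalOp (v : ℕ → E) (M : (ℕ → ℂ) →ₗ[ℂ] (ℕ → ℂ)) : Op E :=
  (maximalGraph v M).toLinearPMap

theorem mem_graph_maximalOp {v : ℕ → E} (hv : Function.Injective (coeff v))
    {M : (ℕ → ℂ) →ₗ[ℂ] (ℕ → ℂ)} {x y : E} :
    (x, y) ∈ (maximalOp v M).graph ↔ coeff v y = M (coeff v x) := by
  rw [maximalOp, Submodule.toLinearPMap_graph_eq]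
  · rfl
  · rintro ⟨x, y⟩ hx h0
    have hx' : coeff v y = M (coeff v x) := hx
    obtain rfl : x = 0 := h0
    rw [map_zero, map_zero] at hx'
    exact hv (by simpa using hx')

/-- The graph of the power `T ^ n`, on its natural domain
`{x ∈ D(T ^ (n-1)) | T ^ (n-1) x ∈ D(T)}`. -/
def powGraph (T : Op E) : ℕ → Set (E × E)
  | 0 => {q | q.1 = q.2}
  | n + 1 => {q | ∃ y, (q.1, y) ∈ powGraph T n ∧ (y, q.2) ∈ T.graph}

/-- An unbounded densely defined operator is chaotic if all its powers are closed, some vector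
has a (well defined) dense orbit, and the periodic points are dense. In `hypercyclic`, the
sequence `x` is the orbit `x n = T ^ n (x 0)`. -/
structure IsChaotic (T : Op E) : Prop where
  dense_domain : Dense (T.domain : Set E)
  unbounded : ¬ ∃ C : ℝ, ∀ x : T.domain, ‖T x‖ ≤ C * ‖(x : E)‖
  isClosed_pow : ∀ n : ℕ, 0 < n → IsClosed (powGraph T n)
  hypercyclic : ∃ x : ℕ → E, (∀ n, (x n, x (n + 1)) ∈ T.graph) ∧ Dense (Set.range x)
  dense_periodic : Dense {x : E | ∃ n : ℕ, 0 < n ∧ (x, x) ∈ powGraph T n}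

end Operators

/-- The coefficients with respect to `e_p, e_{p+1}, …` determine an element of `B_p`. -/
theorem coeff_b_injective (p : ℕ) : Function.Injective (coeff (b p)) := by
  rw [← LinearMap.ker_eq_bot, LinearMap.ker_eq_bot']
  intro φ hφ
  have h0 : ∀ n, ⟪e (p + n), (φ : Lp ℂ 2 gaussian)⟫_ℂ = 0 := fun n => congrFun hφ n
  have h1 : (φ : Lp ℂ 2 gaussian) ∈ (Submodule.span ℂ (e '' Set.Ici p))ᗮ := by
    rw [Submodule.mem_orthogonal]
    intro u hu
    induction hu using Submodule.span_induction with
    | mem x hx =>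
      obtain ⟨k, hk, rfl⟩ := hx
      obtain ⟨n, rfl⟩ := Nat.exists_eq_add_of_le (Set.mem_Ici.1 hk)
      exact h0 n
    | zero => simp
    | add x y _ _ hx hy => rw [inner_add_left, hx, hy, add_zero]
    | smul c x _ hx => rw [inner_smul_left, hx, mul_zero]
  rw [← Submodule.orthogonal_closure] at h1
  have h2 : ⟪(φ : Lp ℂ 2 gaussian), (φ : Lp ℂ 2 gaussian)⟫_ℂ = 0 :=
    (Submodule.mem_orthogonal _ _).1 h1 _ φ.2.2
  exact Subtype.ext (inner_self_eq_zero.1 h2)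

/-! ### The weighted shift -/

/-- The weights `ω_k = √(k! (k+m)!) / (k-p)!`; they are only used for `k ≥ p`. -/
noncomputable def weight (p m k : ℕ) : ℝ :=
  √(k.factorial * (k + m).factorial : ℝ) / (k - p).factorial

/-- The weighted backward shift `e_p ↦ 0`, `e_k ↦ ω_{k-1} e_{k-1}` for `k > p`, as an expression
on coefficient sequences `(a_n)`, where `a_n` is the coefficient of `e_{p+n}`. -/
noncomputable def backward (p m : ℕ) : (ℕ → ℂ) →ₗ[ℂ] (ℕ → ℂ) where
  toFun a n := weight p m (p + n) * a (n + 1)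
  map_add' x y := by ext n; simp [mul_add]
  map_smul' c x := by ext n; simp [mul_left_comm]

/-- The weighted forward shift `e_k ↦ ω_k e_{k+1}` for `k ≥ p`, as an expression on coefficient
sequences `(a_n)`, where `a_n` is the coefficient of `e_{p+n}`. -/
noncomputable def forward (p m : ℕ) : (ℕ → ℂ) →ₗ[ℂ] (ℕ → ℂ) where
  toFun a
    | 0 => 0
    | n + 1 => weight p m (p + n) * a n
  map_add' x y := by ext n; cases n <;> simp [mul_add]
  map_smul' c x := by ext n; cases n <;> simp [mul_left_comm]

/-- The weighted shift `H̆` on `B_p`, with domain `{φ ∈ B_p | H̆ φ ∈ B_p}`. -/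
noncomputable def shift (p m : ℕ) : Op (bargmannSub p) :=
  maximalOp (b p) (backward p m)

/-- The sum `H̆ + H̆*`, that is the expression
`e_p ↦ ω_p e_{p+1}`, `e_k ↦ ω_{k-1} e_{k-1} + ω_k e_{k+1}` for `k > p`,
with its maximal domain `{φ ∈ B_p | (H̆ + H̆*) φ ∈ B_p}`. -/
noncomputable def shiftSum (p m : ℕ) : Op (bargmannSub p) :=
  maximalOp (b p) (backward p m + forward p m)

end HeunBargmann

/-! In the basis `b p` the sum is a Jacobi operator `T` with zero diagonal and off-diagonal entries
`w n = weight p m (p + n)`. Since `w (n + 1) ^ 2 / w n ^ 2` is about `1 + (2p + m) / n`, solutions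
of the homogeneous recurrence have squares of order `n ^ (-(2p + m) / 2)`; the condition `p + m / 2
> 1`, that is `2p + m ≥ 3`, makes them all square summable (the limit circle case,
`summable_recSol_sq`).

Variation of constants then gives a bounded right inverse `R` of Volterra type, with `‖R ^ (k + 1)‖
≤ S ^ (k + 1) / k!` (`tendsto_pow_mul_norm_pow`), and `ker T` is spanned by one vector `u`.
Everything follows from `x ∈ D(T), T x = y ↔ x - R y ∈ ℂ u`. This passes to powers
(`mem_powGraph_iff`), whence closedness.

Put `D = span {R ^ k u}`. On `D` the operator `T` is nilpotent vector by vector, while `R ^ n → 0`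
in norm. Periodic points near `y ∈ D` are `(1 - R ^ N)⁻¹ y`; a vector with dense orbit is a series
of terms `R ^ (N j) (y j)` with sparse `N j`.

The main point is the density of `D` (`dense_span_range_pow`). A rank one perturbation `G` of `R` is
symmetric and agrees with `R*` on `Dᗮ`. Symmetry makes `‖G ^ n x‖` log-convex, so it decays at most
geometrically unless `G x = 0`; quasinilpotence of `R` forces faster decay. Hence `G x = 0`, and `x
= T (G x) = 0`. -/

namespace HeunBargmann

/-! ### Chaos from a quasinilpotent right inverse -/

section Chaos

variable {E : Type*} [NormedAddCommGroup E] [InnerProductSpace ℂ E]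

/-- The span of `u, R u, …, R ^ (n - 1) u`. -/
def krylov (R : E →L[ℂ] E) (u : E) (n : ℕ) : Submodule ℂ E :=
  Submodule.span ℂ ((fun k => (R ^ k) u) '' Set.Iio n)

theorem krylov_succ (R : E →L[ℂ] E) (u : E) (n : ℕ) :
    krylov R u (n + 1) = krylov R u n ⊔ Submodule.span ℂ {(R ^ n) u} := by
  have : Set.Iio (n + 1) = Set.Iio n ∪ {n} := by
    ext k
    simp
  rw [krylov, krylov, this, Set.image_union, Set.image_singleton, Submodule.span_union]

theorem isClosed_krylov (R : E →L[ℂ] E) (u : E) (n : ℕ) : IsClosed (krylov R u n : Set E) := by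
  have : FiniteDimensional ℂ (krylov R u n) :=
    FiniteDimensional.span_of_finite ℂ ((Set.finite_Iio n).image _)
  exact Submodule.closed_of_finiteDimensional _

theorem krylov_mono (R : E →L[ℂ] E) (u : E) : Monotone (krylov R u) := fun _ _ h =>
  Submodule.span_mono (Set.image_mono (Set.Iio_subset_Iio h))

theorem exists_mem_krylov {R : E →L[ℂ] E} {u y : E}
    (hy : y ∈ Submodule.span ℂ (Set.range fun k => (R ^ k) u)) : ∃ n, y ∈ krylov R u n := by
  induction hy using Submodule.span_induction with
  | mem x hx =>
    obtain ⟨k, rfl⟩ := hx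
    exact ⟨k + 1, Submodule.subset_span ⟨k, Nat.lt_succ_self k, rfl⟩⟩
  | zero => exact ⟨0, zero_mem _⟩
  | add x y _ _ hx hy =>
    obtain ⟨n, hn⟩ := hx
    obtain ⟨k, hk⟩ := hy
    exact ⟨max n k, add_mem (krylov_mono R u (le_max_left _ _) hn)
      (krylov_mono R u (le_max_right _ _) hk)⟩
  | smul c x _ hx =>
    obtain ⟨n, hn⟩ := hx
    exact ⟨n, Submodule.smul_mem _ c hn⟩

variable {T : Op E} {R : E →L[ℂ] E} {u : E}

/-- If `T` has the bounded right inverse `R` and its kernel is spanned by `u`, then `T ^ n` has the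
right inverse `R ^ n` and its kernel is spanned by `u, R u, …, R ^ (n - 1) u`. -/
theorem mem_powGraph_iff (hT : ∀ x y, (x, y) ∈ T.graph ↔ x - R y ∈ Submodule.span ℂ {u})
    (n : ℕ) (x y : E) : (x, y) ∈ powGraph T n ↔ x - (R ^ n) y ∈ krylov R u n := by
  induction n generalizing y with
  | zero => simp [powGraph, krylov, sub_eq_zero]
  | succ n ih =>
    have h : (x, y) ∈ powGraph T (n + 1) ↔ ∃ z, (x, z) ∈ powGraph T n ∧ (z, y) ∈ T.graph := Iff.rfl
    rw [h, krylov_succ, Submodule.mem_sup]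
    constructor
    · rintro ⟨z, hxz, hzy⟩
      rw [ih] at hxz
      obtain ⟨c, hc⟩ := Submodule.mem_span_singleton.1 ((hT z y).1 hzy)
      refine ⟨_, hxz, c • (R ^ n) u, Submodule.mem_span_singleton.2 ⟨c, rfl⟩, ?_⟩
      have : z = c • u + R y := by rw [hc]; abel
      rw [this, map_add, map_smul, pow_succ]
      simp only [mul_apply_eq_comp]
      abel
    · rintro ⟨k, hk, k', hk', h⟩
      obtain ⟨c, rfl⟩ := Submodule.mem_span_singleton.1 hk'
      refine ⟨c • u + R y, (ih _).2 ?_, (hT _ _).2 ?_⟩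
      · convert hk using 1
        rw [map_add, map_smul, eq_sub_of_add_eq h, pow_succ]
        simp only [mul_apply_eq_comp]
        abel
      · rw [add_sub_cancel_right]
        exact Submodule.mem_span_singleton.2 ⟨c, rfl⟩

theorem isClosed_powGraph (hT : ∀ x y, (x, y) ∈ T.graph ↔ x - R y ∈ Submodule.span ℂ {u})
    (n : ℕ) : IsClosed (powGraph T n) := by
  have : powGraph T n = (fun q : E × E => q.1 - (R ^ n) q.2) ⁻¹' krylov R u n := by
    ext ⟨x, y⟩
    exact mem_powGraph_iff hT n x y
  rw [this]
  exact (isClosed_krylov R u n).preimage (by fun_prop)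

/-- For `y` in the span and `N` large, `T ^ N y = 0`, so `x = (1 - R ^ N)⁻¹ y` satisfies `T ^ N x =
x`; it tends to `y` as `N` grows. -/
theorem dense_setOf_mem_powGraph [CompleteSpace E]
    (hT : ∀ x y, (x, y) ∈ T.graph ↔ x - R y ∈ Submodule.span ℂ {u})
    (hR : Tendsto (fun n => ‖R ^ n‖) atTop (𝓝 0))
    (hD : Dense (Submodule.span ℂ (Set.range fun k => (R ^ k) u) : Set E)) :
    Dense {x : E | ∃ n : ℕ, 0 < n ∧ (x, x) ∈ powGraph T n} := by
  refine dense_closure.1 (hD.mono fun y hy => Metric.mem_closure_iff.2 fun ε hε => ?_)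
  obtain ⟨d, hd⟩ := exists_mem_krylov hy
  have h2 : Tendsto (fun n => ‖R ^ n‖ * (2 * ‖y‖)) atTop (𝓝 0) := by
    simpa using hR.mul_const (2 * ‖y‖)
  obtain ⟨N, hN1, hN2, hN3, hN4⟩ := ((hR.eventually_lt_const (show (0 : ℝ) < 1 / 2 by norm_num)).and
    ((h2.eventually_lt_const hε).and ((eventually_ge_atTop d).and (eventually_gt_atTop 0)))).exists
  set U := Units.oneSub (R ^ N) (by linarith) with hU
  set x : E := (↑U⁻¹ : E →L[ℂ] E) y with hx
  have hxy : x - (R ^ N) x = y := by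
    have : (U * ↑U⁻¹ : E →L[ℂ] E) y = y := by rw [Units.mul_inv]; rfl
    simpa [hU, mul_apply_eq_comp] using this
  refine ⟨x, ⟨N, hN4, (mem_powGraph_iff hT N x x).2 ?_⟩, ?_⟩
  · rw [hxy]
    exact krylov_mono R u hN3 hd
  · have h3 : ‖(R ^ N) x‖ ≤ ‖R ^ N‖ * ‖x‖ := (R ^ N).le_opNorm x
    have h4 : ‖x‖ ≤ ‖y‖ + ‖(R ^ N) x‖ := by
      rw [← hxy]; simpa using norm_add_le (x - (R ^ N) x) ((R ^ N) x)
    have h5 : ‖x‖ ≤ 2 * ‖y‖ := by nlinarith [norm_nonneg x]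
    rw [dist_eq_norm, ← norm_neg, neg_sub]
    calc ‖x - y‖ = ‖(R ^ N) x‖ := by rw [← hxy]; simp
      _ ≤ ‖R ^ N‖ * (2 * ‖y‖) := h3.trans (by gcongr)
      _ < ε := hN2

/-- `T` undoes `R` and kills `u`, so `R ^ k u` has the orbit `R ^ k u, …, R u, u, 0, 0, …`. -/
theorem exists_finite_orbit (hT : ∀ x y, (x, y) ∈ T.graph ↔ x - R y ∈ Submodule.span ℂ {u})
    {y : E} (hy : y ∈ Submodule.span ℂ (Set.range fun k => (R ^ k) u)) :
    ∃ g : ℕ → E, g 0 = y ∧ (∀ i, (g i, g (i + 1)) ∈ T.graph) ∧ ∃ d, ∀ i, d ≤ i → g i = 0 := by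
  induction hy using Submodule.span_induction with
  | mem x hx =>
    obtain ⟨k, rfl⟩ := hx
    refine ⟨fun i => if i ≤ k then (R ^ (k - i)) u else 0, by simp, fun i => (hT _ _).2 ?_,
      k + 1, fun i hi => if_neg (by omega)⟩
    beta_reduce
    rcases lt_trichotomy i k with h | rfl | h
    · rw [if_pos h.le, if_pos (by omega), show k - i = k - (i + 1) + 1 by omega, pow_succ']
      simp
    · simp [Submodule.mem_span_singleton_self]
    · rw [if_neg (by omega), if_neg (by omega)]
      simp
  | zero => exact ⟨0, rfl, fun i => T.graph.zero_mem, 0, fun _ _ => rfl⟩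
  | add x y _ _ hx hy =>
    obtain ⟨g, g0, hg, d, hd⟩ := hx
    obtain ⟨g', g0', hg', d', hd'⟩ := hy
    refine ⟨g + g', by simp [g0, g0'], fun i => T.graph.add_mem (hg i) (hg' i), max d d',
      fun i hi => ?_⟩
    simp [hd i (le_of_max_le_left hi), hd' i (le_of_max_le_right hi)]
  | smul c x _ hx =>
    obtain ⟨g, g0, hg, d, hd⟩ := hx
    exact ⟨c • g, by simp [g0], fun i => T.graph.smul_mem c (hg i), d, fun i hi => by simp [hd i hi]⟩

/-- The starting vector is `∑ j, R ^ (N j) (y j)`. At time `N i` the terms with `j < i` have died,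
the term `j = i` equals `y i`, and the later ones are still small. -/
theorem exists_dense_orbit [CompleteSpace E]
    (hT : ∀ x y, (x, y) ∈ T.graph ↔ x - R y ∈ Submodule.span ℂ {u})
    (hR : Tendsto (fun n => ‖R ^ n‖) atTop (𝓝 0))
    (hD : Dense (Submodule.span ℂ (Set.range fun k => (R ^ k) u) : Set E)) :
    ∃ x : ℕ → E, (∀ n, (x n, x (n + 1)) ∈ T.graph) ∧ Dense (Set.range x) := by
  set D : Submodule ℂ E := Submodule.span ℂ (Set.range fun k => (R ^ k) u) with hDdef
  have hsep : TopologicalSpace.SeparableSpace E := by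
    have h := ((Set.countable_range fun k => (R ^ k) u).isSeparable.span (R := ℂ)).closure
    rw [hD.closure_eq] at h
    exact TopologicalSpace.isSeparable_univ_iff.1 h
  have := UniformSpace.secondCountable_of_separable E
  set s : ℕ → D := TopologicalSpace.denseSeq D with hs
  have hsd : DenseRange fun j => (s j : E) :=
    hD.denseRange_val.comp (TopologicalSpace.denseRange_denseSeq D) continuous_subtype_val
  -- Unpairing repeats each `s i` at arbitrarily large indices, where the approximation error is
  -- small.
  set y : ℕ → E := fun j => s j.unpair.1 with hy
  choose g g0 hg d hd using fun j => exists_finite_orbit hT (s (Nat.unpair j).1).2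
  have hRy : ∀ j, ∃ τ, ∀ n, τ ≤ n → ‖(R ^ n) (y j)‖ ≤ (1 / 4) ^ j := fun j => by
    have h1 : Tendsto (fun n => ‖R ^ n‖ * ‖y j‖) atTop (𝓝 0) := by
      simpa using hR.mul_const ‖y j‖
    obtain ⟨τ, hτ⟩ := eventually_atTop.1
      (h1.eventually_le_const (show (0 : ℝ) < (1 / 4) ^ j by positivity))
    exact ⟨τ, fun n hn => ((R ^ n).le_opNorm _).trans (hτ n hn)⟩
  choose τ hτ using hRy
  -- Between consecutive times, `d j` steps let the current term die and `τ (j + 1)` powers of `R`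
  -- make the next one small; the `1` makes `N` strictly increasing.
  set N : ℕ → ℕ := fun j => ∑ i ∈ Finset.range j, (d i + τ (i + 1) + 1) with hN
  have hNsucc : ∀ j, N (j + 1) = N j + (d j + τ (j + 1) + 1) := fun j => Finset.sum_range_succ _ j
  have hNmono : StrictMono N := strictMono_nat_of_lt_succ fun j => by rw [hNsucc]; omega
  have hNd : ∀ i j, i < j → N i + d i ≤ N j := fun i j hij => by
    have := hNmono.monotone (show i + 1 ≤ j from hij)
    rw [hNsucc] at this
    omega
  have hNτ : ∀ i j, i < j → N i + τ j ≤ N j := fun i j hij => by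
    obtain ⟨k, rfl⟩ : ∃ k, j = k + 1 := ⟨j - 1, by omega⟩
    have := hNmono.monotone (show i ≤ k by omega)
    rw [hNsucc]
    omega
  -- The orbit of `R ^ N j (y j)`.
  set f : ℕ → ℕ → E := fun j n => if n ≤ N j then (R ^ (N j - n)) (y j) else g j (n - N j) with hf
  have hfg : ∀ j n, N j ≤ n → f j n = g j (n - N j) := fun j n hn => by
    rcases hn.eq_or_lt with rfl | h
    · simp [hf, g0, hy]
    · simp [hf, h.not_ge]
  have hfgraph : ∀ j n, (f j n, f j (n + 1)) ∈ T.graph := fun j n => by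
    rcases le_or_gt (N j) n with h | h
    · rw [hfg j n h, hfg j (n + 1) (by omega), show n + 1 - N j = n - N j + 1 by omega]
      exact hg j _
    · rw [hT]
      simp only [hf, if_pos h.le, if_pos (Nat.succ_le_of_lt h)]
      rw [show N j - n = N j - (n + 1) + 1 by omega, pow_succ']
      simp
  have hfsmall : ∀ i j n, i < j → n ≤ N i → ‖f j n‖ ≤ (1 / 4) ^ j := fun i j n hij hn => by
    have h1 := hNτ i j hij
    simp only [hf]
    rw [if_pos (by omega)]
    exact hτ j _ (by omega)
  have hsum : ∀ n, Summable fun j => f j n := fun n => by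
    refine Summable.of_norm_bounded_eventually_nat (g := fun j => (1 / 4 : ℝ) ^ j)
      (summable_geometric_of_lt_one (by norm_num) (by norm_num)) ?_
    filter_upwards [eventually_gt_atTop n] with j hj
    exact hfsmall n j n hj (hNmono.id_le n)
  refine ⟨fun n => ∑' j, f j n, fun n => ?_, ?_⟩
  -- Closedness of `T` lets it be applied to the series term by term.
  · have hcl : IsClosed (T.graph : Set (E × E)) := by
      have h := isClosed_powGraph hT 1
      have h2 : powGraph T 1 = T.graph := by
        ext ⟨a, c⟩
        simp [powGraph]
      rwa [h2] at h
    have h := (hsum n).hasSum.prodMk (hsum (n + 1)).hasSum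
    exact hcl.mem_of_tendsto h (Eventually.of_forall fun F => Submodule.sum_mem _ fun j _ =>
      hfgraph j n)
  · have hclose : ∀ i, ‖∑' j, f j (N i) - y i‖ ≤ (1 / 2) ^ i * 2 := fun i => by
      have h1 : HasSum (fun j => f j (N i) - if j = i then y i else 0)
          (∑' j, f j (N i) - y i) := (hsum (N i)).hasSum.sub (hasSum_ite_eq i (y i))
      rw [← h1.tsum_eq]
      refine tsum_of_norm_bounded (hasSum_geometric_two.mul_left ((1 / 2 : ℝ) ^ i)) fun j => ?_
      rcases lt_trichotomy j i with h | rfl | h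
      · have h2 := hNd j i h
        rw [if_neg h.ne, hfg j _ (by omega), hd j _ (by omega)]
        simp
      · simp only [hf]
        simp
      · rw [if_neg h.ne', sub_zero]
        refine (hfsmall i j _ h le_rfl).trans ?_
        rw [show (1 / 4 : ℝ) = 1 / 2 * (1 / 2) by norm_num, mul_pow]
        have : (1 / 2 : ℝ) ^ j ≤ (1 / 2) ^ i :=
          pow_le_pow_of_le_one (by norm_num) (by norm_num) h.le
        gcongr
    rw [Metric.dense_iff]
    intro z ε hε
    obtain ⟨i, hi⟩ := hsd.exists_dist_lt z (half_pos hε)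
    have hlim : Tendsto (fun n : ℕ => (1 / 2 : ℝ) ^ n * 2) atTop (𝓝 0) := by
      simpa using (tendsto_pow_atTop_nhds_zero_of_lt_one (r := (1 / 2 : ℝ)) (by norm_num)
        (by norm_num)).mul_const 2
    obtain ⟨K, hK⟩ := eventually_atTop.1 (hlim.eventually_lt_const (half_pos hε))
    refine ⟨_, ?_, ⟨N (Nat.pair i K), rfl⟩⟩
    have h1 := hclose (Nat.pair i K)
    have h2 := hK _ (Nat.right_le_pair i K)
    have h3 : y (Nat.pair i K) = s i := by simp [hy]
    rw [h3, ← dist_eq_norm] at h1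
    rw [Metric.mem_ball]
    rw [dist_comm] at hi
    linarith [dist_triangle (∑' j, f j (N (Nat.pair i K))) (s i : E) z]

theorem norm_inner_self_eq_sq (x : E) : ‖⟪x, x⟫_ℂ‖ = ‖x‖ ^ 2 := by
  rw [inner_self_eq_norm_sq_to_K]
  simp

/-- For `x` orthogonal to the span, log-convexity of `‖G ^ n x‖` is played against the
superexponential decay of `‖R ^ n‖`. -/
theorem dense_span_range_pow [CompleteSpace E]
    (hT : ∀ x y, (x, y) ∈ T.graph ↔ x - R y ∈ Submodule.span ℂ {u})
    (hR : ∀ C : ℝ, Tendsto (fun n => C ^ n * ‖R ^ n‖) atTop (𝓝 0)) {q : E}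
    (hG : ∀ x y, ⟪R x + ⟪q, x⟫_ℂ • u, y⟫_ℂ = ⟪x, R y + ⟪q, y⟫_ℂ • u⟫_ℂ) :
    Dense (Submodule.span ℂ (Set.range fun k => (R ^ k) u) : Set E) := by
  rw [Submodule.dense_iff_topologicalClosure_eq_top, Submodule.topologicalClosure_eq_top_iff,
    Submodule.eq_bot_iff]
  intro x hx
  set D : Submodule ℂ E := Submodule.span ℂ (Set.range fun k => (R ^ k) u) with hDdef
  set G : E → E := fun x => R x + ⟪q, x⟫_ℂ • u with hGdef
  have hDu : ∀ k, (R ^ k) u ∈ D := fun k => Submodule.subset_span ⟨k, rfl⟩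
  -- The rank one term drops out because `u ∈ D`: on `Dᗮ` the symmetric `G` acts as the adjoint of
  -- `R`.
  have hadj : ∀ x ∈ Dᗮ, ∀ z, ⟪z, G x⟫_ℂ = ⟪R z, x⟫_ℂ := fun x hx z => by
    have h0 : ⟪u, x⟫_ℂ = 0 := (Submodule.mem_orthogonal _ _).1 hx _ (hDu 0)
    rw [← hG, inner_add_left, inner_smul_left, h0, mul_zero, add_zero]
  have hinv : ∀ x ∈ Dᗮ, G x ∈ Dᗮ := fun x hx => by
    rw [Submodule.mem_orthogonal]
    intro z hz
    rw [hadj x hx]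
    refine (Submodule.mem_orthogonal _ _).1 hx _ ?_
    induction hz using Submodule.span_induction with
    | mem z hz =>
      obtain ⟨k, rfl⟩ := hz
      have := hDu (k + 1)
      rwa [pow_succ'] at this
    | zero => simp
    | add a c _ _ ha hc => rw [map_add]; exact add_mem ha hc
    | smul c a _ ha => rw [map_smul]; exact Submodule.smul_mem _ c ha
  have hiter : ∀ n, G^[n] x ∈ Dᗮ := fun n => by
    induction n with
    | zero => exact hx
    | succ n ih => rw [Function.iterate_succ_apply']; exact hinv _ ih
  have hpow : ∀ n z, ⟪z, G^[n] x⟫_ℂ = ⟪(R ^ n) z, x⟫_ℂ := fun n => by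
    induction n with
    | zero => intro z; rfl
    | succ n ih =>
      intro z
      rw [Function.iterate_succ_apply', hadj _ (hiter n), ih, pow_succ]
      rfl
  have hle : ∀ n, ‖G^[n] x‖ ≤ ‖R ^ n‖ * ‖x‖ := fun n => by
    have h1 : ‖G^[n] x‖ ^ 2 ≤ ‖R ^ n‖ * ‖x‖ * ‖G^[n] x‖ := by
      rw [← norm_inner_self_eq_sq, hpow]
      refine (norm_inner_le_norm _ _).trans ?_
      calc _ ≤ ‖R ^ n‖ * ‖G^[n] x‖ * ‖x‖ := by gcongr; exact (R ^ n).le_opNorm _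
        _ = _ := by ring
    by_contra! h
    nlinarith [norm_nonneg (G^[n] x), mul_nonneg (norm_nonneg (R ^ n)) (norm_nonneg x)]
  have hconv : ∀ n, ‖G^[n + 1] x‖ ^ 2 ≤ ‖G^[n] x‖ * ‖G^[n + 2] x‖ := fun n => by
    rw [← norm_inner_self_eq_sq]
    nth_rw 1 [Function.iterate_succ_apply']
    rw [hG, Function.iterate_succ_apply' G (n + 1)]
    exact norm_inner_le_norm _ _
  have hGx : G x = 0 := by
    by_contra h
    have hx0 : x ≠ 0 := by
      rintro rfl
      simp [hGdef] at h
    have h1 : 0 < ‖G x‖ := norm_pos_iff.2 h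
    have h0 : 0 < ‖x‖ := norm_pos_iff.2 hx0
    set C := ‖x‖ / ‖G x‖ with hC
    have hC0 : 0 < C := by positivity
    -- By log-convexity the ratios of consecutive norms increase, so the first one, `1 / C`, bounds
    -- them all from below.
    have hstep : ∀ n, ‖G^[n] x‖ ≤ C * ‖G^[n + 1] x‖ := fun n => by
      induction n with
      | zero =>
        simp only [Function.iterate_zero, id, zero_add, Function.iterate_one, hC]
        field_simp
        exact le_rfl
      | succ n ih =>
        have h2 := hconv n
        by_contra! h3
        have h4 : 0 < ‖G^[n + 1] x‖ := lt_of_le_of_lt (by positivity) h3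
        nlinarith [norm_nonneg (G^[n + 2] x)]
    have hall : ∀ n, ‖x‖ ≤ C ^ n * ‖G^[n] x‖ := fun n => by
      induction n with
      | zero => simp
      | succ n ih =>
        refine ih.trans ?_
        rw [pow_succ, mul_assoc]
        gcongr
        exact hstep n
    have hlim : Tendsto (fun n => C ^ n * ‖R ^ n‖ * ‖x‖) atTop (𝓝 0) := by
      simpa using (hR C).mul_const ‖x‖
    refine absurd (ge_of_tendsto' hlim fun n => ?_) h0.not_ge
    refine (hall n).trans ?_
    rw [mul_assoc]
    gcongr
    exact hle n
  -- `G` differs from `R` by a multiple of `u`, so it is also a right inverse of `T`.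
  have h1 : (G x, x) ∈ T.graph := (hT _ _).2 (by
    simp only [hGdef, add_sub_cancel_left]
    exact Submodule.mem_span_singleton.2 ⟨_, rfl⟩)
  exact T.graph_fst_eq_zero_snd h1 hGx

/-- An operator with one-dimensional kernel `ℂ u` and a quasinilpotent right inverse `R` is chaotic
if some rank one perturbation `R + ⟪q, ·⟫ u` of `R`, which is another right inverse, is symmetric. -/
theorem IsChaotic.of_quasinilpotent [CompleteSpace E] (hu : u ≠ 0)
    (hT : ∀ x y, (x, y) ∈ T.graph ↔ x - R y ∈ Submodule.span ℂ {u})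
    (hR : ∀ C : ℝ, Tendsto (fun n => C ^ n * ‖R ^ n‖) atTop (𝓝 0)) {q : E}
    (hG : ∀ x y, ⟪R x + ⟪q, x⟫_ℂ • u, y⟫_ℂ = ⟪x, R y + ⟪q, y⟫_ℂ • u⟫_ℂ) :
    IsChaotic T := by
  have hD := dense_span_range_pow hT hR hG
  have hR1 : Tendsto (fun n => ‖R ^ n‖) atTop (𝓝 0) := by simpa using hR 1
  have hRT : ∀ y, (R y, y) ∈ T.graph := fun y => (hT _ _).2 (by simp)
  refine ⟨hD.mono fun x hx => ?_, ?_, fun n _ => isClosed_powGraph hT n,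
    exists_dense_orbit hT hR1 hD, dense_setOf_mem_powGraph hT hR1 hD⟩
  · obtain ⟨g, rfl, hg, -⟩ := exists_finite_orbit hT hx
    exact T.mem_domain_of_mem_graph (hg 0)
  -- A bound `C` for `T` would give `‖u‖ ≤ |C| ^ n * ‖R ^ n u‖`, which tends to `0`.
  · rintro ⟨C, hC⟩
    have h1 : ∀ y, ‖y‖ ≤ |C| * ‖R y‖ := fun y => by
      obtain ⟨z, hz1, hz2⟩ := (T.mem_graph_iff).1 (hRT y)
      have h := hC z
      simp only at hz1 hz2
      rw [hz1, hz2] at h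
      exact h.trans (by gcongr; exact le_abs_self C)
    have h2 : ∀ n, ‖u‖ ≤ |C| ^ n * ‖(R ^ n) u‖ := fun n => by
      induction n with
      | zero => simp
      | succ n ih =>
        refine ih.trans ?_
        rw [pow_succ, mul_assoc, pow_succ']
        gcongr
        exact h1 _
    have hlim : Tendsto (fun n => |C| ^ n * ‖R ^ n‖ * ‖u‖) atTop (𝓝 0) := by
      simpa using (hR |C|).mul_const ‖u‖
    refine absurd (ge_of_tendsto' hlim fun n => ?_) (norm_pos_iff.2 hu).not_ge
    refine (h2 n).trans ?_
    rw [mul_assoc]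
    gcongr
    exact (R ^ n).le_opNorm u

end Chaos

/-! ### Coefficients with respect to a Hilbert basis -/

section Coefficients

variable {E : Type*} [NormedAddCommGroup E] [InnerProductSpace ℂ E] (v : HilbertBasis ℕ ℂ E)

theorem coeff_apply (x : E) (n : ℕ) : coeff v x n = ⟪v n, x⟫_ℂ := rfl

theorem coeff_injective : Function.Injective (coeff v) := fun x y h => by
  refine v.repr.injective (lp.ext (funext fun n => ?_))
  rw [v.repr_apply_apply, v.repr_apply_apply]
  exact congrFun h n

theorem coeff_self (i : ℕ) : coeff v (v i) = Pi.single i 1 := by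
  ext n
  rw [coeff_apply, orthonormal_iff_ite.1 v.orthonormal]
  simp [Pi.single_apply]

theorem exists_coeff_eq {a : ℕ → ℂ} (ha : Summable fun n => ‖a n‖ ^ 2) :
    ∃ x, coeff v x = a := by
  have h : Memℓp a 2 := (memℓp_gen_iff (by norm_num)).2 (by simpa using ha)
  refine ⟨v.repr.symm ⟨a, h⟩, funext fun n => ?_⟩
  rw [coeff_apply, ← v.repr_apply_apply, LinearIsometryEquiv.apply_symm_apply]

theorem hasSum_norm_coeff_sq (x : E) : HasSum (fun n => ‖coeff v x n‖ ^ 2) (‖x‖ ^ 2) := by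
  have h := v.hasSum_inner_mul_inner x x
  rw [inner_self_eq_norm_sq_to_K] at h
  have h1 : ∀ n, ⟪x, v n⟫_ℂ * ⟪v n, x⟫_ℂ = ((‖coeff v x n‖ ^ 2 : ℝ) : ℂ) := fun n => by
    rw [← inner_conj_symm x (v n), RCLike.conj_mul, coeff_apply]
    norm_cast
  simp only [h1] at h
  rw [← RCLike.ofReal_pow] at h
  exact Complex.hasSum_ofReal.1 h

theorem norm_le_of_norm_coeff_le {ρ : ℕ → ℝ} (hρ : Summable fun n => ρ n ^ 2) {K : ℝ} (hK : 0 ≤ K)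
    {x : E} (hx : ∀ n, ‖coeff v x n‖ ≤ K * ρ n) : ‖x‖ ≤ K * √(∑' n, ρ n ^ 2) := by
  have h1 : ‖x‖ ^ 2 ≤ K ^ 2 * ∑' n, ρ n ^ 2 := by
    refine hasSum_le (fun n => ?_) (hasSum_norm_coeff_sq v x) (hρ.hasSum.mul_left (K ^ 2))
    rw [← mul_pow]
    exact pow_le_pow_left₀ (norm_nonneg _) (hx n) 2
  rw [← Real.sqrt_sq hK, ← Real.sqrt_mul (sq_nonneg K)]
  exact Real.le_sqrt_of_sq_le h1

theorem sum_mul_norm_coeff_le {ρ : ℕ → ℝ} (hρ : Summable fun n => ρ n ^ 2) (x : E)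
    (s : Finset ℕ) : ∑ i ∈ s, ρ i * ‖coeff v x i‖ ≤ √(∑' n, ρ n ^ 2) * ‖x‖ := by
  refine le_trans (Real.sum_mul_le_sqrt_mul_sqrt s ρ _) ?_
  gcongr
  · exact hρ.sum_le_tsum s fun i _ => sq_nonneg _
  · exact Real.sqrt_le_iff.2 ⟨norm_nonneg _, v.orthonormal.sum_inner_products_le x⟩

/-- Domination by one square summable sequence gives both existence of the image and boundedness;
linearity is inherited because coefficients determine vectors. -/
theorem exists_clm_coeff_eq (N : (ℕ → ℂ) →ₗ[ℂ] (ℕ → ℂ)) {ρ : ℕ → ℝ}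
    (hρ : Summable fun n => ρ n ^ 2) {C : ℝ} (hC : 0 ≤ C)
    (hN : ∀ x n, ‖N (coeff v x) n‖ ≤ C * ‖x‖ * ρ n) :
    ∃ R : E →L[ℂ] E, ∀ x, coeff v (R x) = N (coeff v x) := by
  have h : ∀ x, ∃ y, coeff v y = N (coeff v x) := fun x => by
    refine exists_coeff_eq v (Summable.of_nonneg_of_le (fun _ => sq_nonneg _) (fun n => ?_)
      (hρ.mul_left ((C * ‖x‖) ^ 2)))
    rw [← mul_pow]
    exact pow_le_pow_left₀ (norm_nonneg _) (hN x n) 2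
  choose r hr using h
  let L : E →ₗ[ℂ] E :=
    { toFun := r
      map_add' := fun x y => coeff_injective v (by simp [hr])
      map_smul' := fun c x => coeff_injective v (by simp [hr]) }
  refine ⟨L.mkContinuous (C * √(∑' n, ρ n ^ 2)) fun x => ?_, hr⟩
  refine (norm_le_of_norm_coeff_le v hρ (K := C * ‖x‖) (by positivity) fun n => ?_).trans_eq
    (by ring)
  change ‖coeff v (r x) n‖ ≤ _
  rw [hr]
  exact hN x n

end Coefficients

/-! ### The three term recurrence -/

section Recurrence

variable (w : ℕ → ℝ)

/-- The solution of `w (n + 1) u (n + 2) + w n u n = 0` with `u 0 = a`, `u 1 = c`. -/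
noncomputable def recSol (a c : ℝ) : ℕ → ℝ
  | 0 => a
  | 1 => c
  | n + 2 => -(w n / w (n + 1)) * recSol a c n

/-- Raabe's test, in the form of a telescoping sum. -/
theorem summable_recSol_sq {w : ℕ → ℝ} (hw : ∀ n, 0 < w n)
    (hgrow : ∀ n : ℕ, (n + 4) * w n ^ 2 ≤ (n + 1) * w (n + 1) ^ 2) (a c : ℝ) :
    Summable fun n => recSol w a c n ^ 2 := by
  set s : ℕ → ℝ := fun n => recSol w a c n ^ 2 with hs
  have hs0 : ∀ n, 0 ≤ s n := fun n => sq_nonneg _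
  have hstep : ∀ n : ℕ, (n + 4) * s (n + 2) ≤ (n + 1) * s n := fun n => by
    have h1 : s (n + 2) * w (n + 1) ^ 2 = w n ^ 2 * s n := by
      have := (hw (n + 1)).ne'
      simp only [hs, recSol]
      field_simp
    have h2 : 0 < w (n + 1) ^ 2 := pow_pos (hw _) 2
    refine le_of_mul_le_mul_right ?_ h2
    calc (n + 4) * s (n + 2) * w (n + 1) ^ 2 = (n + 4) * w n ^ 2 * s n := by
          rw [mul_assoc, h1, mul_assoc]
      _ ≤ (n + 1) * w (n + 1) ^ 2 * s n := mul_le_mul_of_nonneg_right (hgrow n) (hs0 n)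
      _ = _ := by ring
  -- The left side is nonincreasing in `N`, by `hstep`. Two boundary terms are needed since the
  -- recurrence links indices at distance two.
  have hsum : ∀ N : ℕ, ∑ i ∈ Finset.range N, s i + (N + 2) * s N + (N + 3) * s (N + 1) ≤
      2 * s 0 + 3 * s 1 := fun N => by
    induction N with
    | zero => simp
    | succ N ih =>
      rw [Finset.sum_range_succ]
      push_cast
      linarith [hstep N]
  refine summable_of_sum_range_le (c := 2 * s 0 + 3 * s 1) hs0 fun N => ?_
  have h1 : 0 ≤ (N + 2) * s N := mul_nonneg (by positivity) (hs0 N)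
  have h2 : 0 ≤ (N + 3) * s (N + 1) := mul_nonneg (by positivity) (hs0 _)
  linarith [hsum N]

/-- The solution with initial values `1, 0`. -/
noncomputable def solP : ℕ → ℝ := recSol w 1 0

/-- The solution with initial values `0, 1 / w 0`. -/
noncomputable def solQ : ℕ → ℝ := recSol w 0 (1 / w 0)

/-- The kernel `Q n P m - P n Q m`. -/
noncomputable def wronskianKernel (n m : ℕ) : ℝ := solQ w n * solP w m - solP w n * solQ w m

theorem wronskianKernel_add_two (n m : ℕ) :
    wronskianKernel w (n + 2) m = -(w n / w (n + 1)) * wronskianKernel w n m := by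
  simp only [wronskianKernel, solP, solQ, recSol]
  ring

theorem wronskianKernel_self (n : ℕ) : wronskianKernel w n n = 0 := by
  simp [wronskianKernel, mul_comm]

theorem wronskianKernel_swap (n m : ℕ) : wronskianKernel w n m = -wronskianKernel w m n := by
  simp only [wronskianKernel]
  ring

variable {w} in
-- Constancy of the Wronskian; the initial value `1 / w 0` of `solQ` normalizes it to `1`.
theorem mul_wronskianKernel_succ (hw : ∀ n, 0 < w n) (n : ℕ) :
    w n * wronskianKernel w (n + 1) n = 1 := by
  induction n with
  | zero =>
    have := (hw 0).ne'
    simp [wronskianKernel, solP, solQ, recSol, this]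
  | succ n ih =>
    have := (hw (n + 1)).ne'
    rw [wronskianKernel_add_two, wronskianKernel_swap, ← ih]
    field_simp

/-- The norm of the pair `(P n, Q n)`. -/
noncomputable def solNorm (n : ℕ) : ℝ := √(solP w n ^ 2 + solQ w n ^ 2)

theorem solNorm_sq (n : ℕ) : solNorm w n ^ 2 = solP w n ^ 2 + solQ w n ^ 2 :=
  Real.sq_sqrt (by positivity)

theorem solNorm_nonneg (n : ℕ) : 0 ≤ solNorm w n := Real.sqrt_nonneg _

/-- The kernel is the determinant of two plane vectors `(P, Q)`, hence at most the product of their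
lengths. -/
theorem abs_wronskianKernel_le (n m : ℕ) :
    |wronskianKernel w n m| ≤ solNorm w n * solNorm w m := by
  refine abs_le_of_sq_le_sq ?_ (mul_nonneg (solNorm_nonneg w n) (solNorm_nonneg w m))
  rw [mul_pow, solNorm_sq, solNorm_sq, wronskianKernel]
  nlinarith [sq_nonneg (solQ w n * solQ w m + solP w n * solP w m)]

variable {w} in
theorem summable_solNorm_sq (hw : ∀ n, 0 < w n)
    (hgrow : ∀ n : ℕ, (n + 4) * w n ^ 2 ≤ (n + 1) * w (n + 1) ^ 2) :
    Summable fun n => solNorm w n ^ 2 := by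
  simp only [solNorm_sq]
  exact (summable_recSol_sq hw hgrow _ _).add (summable_recSol_sq hw hgrow _ _)

/-- The solution of the recurrence with right-hand side `f` and vanishing initial values. -/
noncomputable def volterra : (ℕ → ℂ) →ₗ[ℂ] (ℕ → ℂ) where
  toFun f n := ∑ m ∈ Finset.range n, (wronskianKernel w n m : ℂ) * f m
  map_add' x y := by ext n; simp [mul_add, Finset.sum_add_distrib]
  map_smul' c x := by ext n; simp [mul_left_comm, Finset.mul_sum]

theorem volterra_apply (f : ℕ → ℂ) (n : ℕ) :
    volterra w f n = ∑ m ∈ Finset.range n, (wronskianKernel w n m : ℂ) * f m := rfl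

theorem norm_volterra_le (f : ℕ → ℂ) (n : ℕ) :
    ‖volterra w f n‖ ≤ (∑ m ∈ Finset.range n, solNorm w m * ‖f m‖) * solNorm w n := by
  rw [volterra_apply, Finset.sum_mul]
  refine (norm_sum_le _ _).trans (Finset.sum_le_sum fun m _ => ?_)
  rw [norm_mul, Complex.norm_real, Real.norm_eq_abs]
  calc _ ≤ solNorm w n * solNorm w m * ‖f m‖ := by
        gcongr; exact abs_wronskianKernel_le w n m
    _ = _ := by ring

theorem pow_succ_add_le {a d : ℝ} (ha : 0 ≤ a) (hd : 0 ≤ d) (k : ℕ) :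
    a ^ (k + 1) + (k + 1) * (d * a ^ k) ≤ (a + d) ^ (k + 1) := by
  induction k with
  | zero => simp
  | succ k ih =>
    have h1 := mul_le_mul_of_nonneg_left ih (add_nonneg ha hd)
    have h2 : 0 ≤ (k + 1) * (d * d * a ^ k) := by positivity
    rw [pow_succ' (a + d)]
    refine le_trans ?_ h1
    push_cast
    ring_nf at h2 ⊢
    linarith

/-- Discrete form of `(k + 1) ∫ σ' σ ^ k = σ ^ (k + 1)`; it produces the factorial in the bound for
iterated Volterra operators. -/
theorem sum_mul_pow_sum_le {δ : ℕ → ℝ} (hδ : ∀ n, 0 ≤ δ n) (k n : ℕ) :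
    (k + 1) * ∑ m ∈ Finset.range n, δ m * (∑ i ∈ Finset.range m, δ i) ^ k ≤
      (∑ i ∈ Finset.range n, δ i) ^ (k + 1) := by
  induction n with
  | zero => simp
  | succ n ih =>
    rw [Finset.sum_range_succ, Finset.sum_range_succ, mul_add]
    linarith [pow_succ_add_le (Finset.sum_nonneg fun i (_ : i ∈ Finset.range n) => hδ i) (hδ n) k]

end Recurrence

/-! ### Jacobi operators in the limit circle case -/

section Jacobi

/-- `M` is the Jacobi matrix with vanishing diagonal and off-diagonal entries `w`. -/
def IsJacobi (w : ℕ → ℝ) (M : (ℕ → ℂ) →ₗ[ℂ] (ℕ → ℂ)) : Prop :=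
  (∀ a, M a 0 = w 0 * a 1) ∧ ∀ a n, M a (n + 1) = w (n + 1) * a (n + 2) + w n * a n

variable {w : ℕ → ℝ} {M : (ℕ → ℂ) →ₗ[ℂ] (ℕ → ℂ)}

/-- Variation of constants. In row `n + 1` the terms with `m < n` cancel by the recurrence, `m = n`
vanishes with the diagonal of the kernel, and `m = n + 1` has coefficient `1`, the Wronskian. -/
theorem IsJacobi.apply_volterra (hM : IsJacobi w M) (hw : ∀ n, 0 < w n) (f : ℕ → ℂ) :
    M (volterra w f) = f := by
  ext n
  have hW : ∀ n, (w n : ℂ) * wronskianKernel w (n + 1) n = 1 := fun n => by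
    exact_mod_cast mul_wronskianKernel_succ hw n
  cases n with
  | zero =>
    rw [hM.1, volterra_apply, Finset.sum_range_one, ← mul_assoc, hW, one_mul]
  | succ n =>
    have h0 : (w (n + 1) : ℂ) ≠ 0 := by exact_mod_cast (hw (n + 1)).ne'
    have hK : ∀ m, (w (n + 1) : ℂ) * wronskianKernel w (n + 2) m =
        -(w n * wronskianKernel w n m) := fun m => by
      rw [wronskianKernel_add_two]
      push_cast
      field_simp
    have h1 : (w (n + 1) : ℂ) * (wronskianKernel w (n + 2) n * f n) = 0 := by
      rw [← mul_assoc, hK, wronskianKernel_self]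
      simp
    have h2 : (w (n + 1) : ℂ) * ∑ m ∈ Finset.range n, wronskianKernel w (n + 2) m * f m =
        -(w n * ∑ m ∈ Finset.range n, wronskianKernel w n m * f m) := by
      rw [Finset.mul_sum, Finset.mul_sum, ← Finset.sum_neg_distrib]
      refine Finset.sum_congr rfl fun m _ => ?_
      rw [← mul_assoc, hK]
      ring
    rw [hM.2, volterra_apply, volterra_apply, Finset.sum_range_succ, Finset.sum_range_succ,
      mul_add, mul_add, h1, h2, ← mul_assoc, hW]
    ring

theorem IsJacobi.apply_solP (hM : IsJacobi w M) (hw : ∀ n, 0 < w n) :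
    M (fun n => (solP w n : ℂ)) = 0 := by
  ext n
  cases n with
  | zero => simp [hM.1, solP, recSol]
  | succ n =>
    have h0 : (w (n + 1) : ℂ) ≠ 0 := by exact_mod_cast (hw (n + 1)).ne'
    simp only [hM.2, solP, recSol, Pi.zero_apply]
    push_cast
    field_simp
    ring

theorem IsJacobi.eq_smul_solP (hM : IsJacobi w M) (hw : ∀ n, 0 < w n) {a : ℕ → ℂ}
    (ha : M a = 0) : a = a 0 • fun n => (solP w n : ℂ) := by
  have h0 : ∀ n, (w n : ℂ) ≠ 0 := fun n => by exact_mod_cast (hw n).ne'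
  ext n
  induction n using Nat.twoStepInduction with
  | zero => simp [solP, recSol]
  | one =>
    have h := congrFun ha 0
    rw [hM.1] at h
    simpa [solP, recSol, h0] using h
  | more n ih _ =>
    have h := congrFun ha (n + 1)
    rw [hM.2, Pi.zero_apply] at h
    have h1 : a (n + 2) = -(w n / w (n + 1)) * a n := by
      have := h0 (n + 1)
      field_simp
      linear_combination h
    simp only [Pi.smul_apply, smul_eq_mul] at ih ⊢
    rw [h1, ih]
    simp only [solP, recSol]
    push_cast
    ring

variable {E : Type*} [NormedAddCommGroup E] [InnerProductSpace ℂ E]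

theorem norm_coeff_pow_le (v : HilbertBasis ℕ ℂ E) (hρ : Summable fun n => solNorm w n ^ 2)
    {R : E →L[ℂ] E} (hR : ∀ x, coeff v (R x) = volterra w (coeff v x)) (k : ℕ) (x : E) (n : ℕ) :
    ‖coeff v ((R ^ (k + 1)) x) n‖ ≤ √(∑' i, solNorm w i ^ 2) * ‖x‖ *
      ((∑ i ∈ Finset.range n, solNorm w i ^ 2) ^ k / k.factorial) * solNorm w n := by
  induction k generalizing n with
  | zero =>
    simp only [zero_add, pow_one, pow_zero, Nat.factorial_zero, Nat.cast_one, div_one, mul_one]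
    rw [hR]
    refine (norm_volterra_le w _ n).trans ?_
    gcongr
    · exact solNorm_nonneg w n
    · exact sum_mul_norm_coeff_le v hρ x _
  | succ k ih =>
    set A := √(∑' i, solNorm w i ^ 2) * ‖x‖ with hA
    have hA0 : 0 ≤ A := by positivity
    rw [pow_succ', mul_apply_eq_comp, hR]
    refine (norm_volterra_le w _ n).trans ?_
    refine mul_le_mul_of_nonneg_right ?_ (solNorm_nonneg w n)
    calc ∑ m ∈ Finset.range n, solNorm w m * ‖coeff v ((R ^ (k + 1)) x) m‖
        ≤ ∑ m ∈ Finset.range n, A / k.factorial *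
          (solNorm w m ^ 2 * (∑ i ∈ Finset.range m, solNorm w i ^ 2) ^ k) := by
          refine Finset.sum_le_sum fun m _ => ?_
          refine (mul_le_mul_of_nonneg_left (ih m) (solNorm_nonneg w m)).trans_eq ?_
          ring
      _ = A / (k + 1).factorial * ((k + 1) * ∑ m ∈ Finset.range n,
          (solNorm w m ^ 2 * (∑ i ∈ Finset.range m, solNorm w i ^ 2) ^ k)) := by
          rw [← Finset.mul_sum, Nat.factorial_succ]
          have : (k.factorial : ℝ) ≠ 0 := by positivity
          push_cast
          field_simp
      _ ≤ A / (k + 1).factorial * (∑ i ∈ Finset.range n, solNorm w i ^ 2) ^ (k + 1) := by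
          gcongr
          exact sum_mul_pow_sum_le (fun _ => sq_nonneg _) k n
      _ = _ := by ring

theorem tendsto_pow_mul_norm_pow (v : HilbertBasis ℕ ℂ E)
    (hρ : Summable fun n => solNorm w n ^ 2)
    {R : E →L[ℂ] E} (hR : ∀ x, coeff v (R x) = volterra w (coeff v x)) (C : ℝ) :
    Tendsto (fun n => C ^ n * ‖R ^ n‖) atTop (𝓝 0) := by
  set S := ∑' i, solNorm w i ^ 2 with hS
  have hS0 : 0 ≤ S := tsum_nonneg fun _ => sq_nonneg _
  have hnorm : ∀ k, ‖R ^ (k + 1)‖ ≤ S * (S ^ k / k.factorial) := fun k => by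
    refine ContinuousLinearMap.opNorm_le_bound _ (by positivity) fun x => ?_
    refine (norm_le_of_norm_coeff_le v hρ (K := √S * ‖x‖ * (S ^ k / k.factorial)) (by positivity)
      fun n => ?_).trans_eq ?_
    · refine (norm_coeff_pow_le v hρ hR k x n).trans ?_
      have h1 : ∑ i ∈ Finset.range n, solNorm w i ^ 2 ≤ S :=
        hρ.sum_le_tsum _ fun i _ => sq_nonneg _
      have h2 : 0 ≤ ∑ i ∈ Finset.range n, solNorm w i ^ 2 :=
        Finset.sum_nonneg fun i _ => sq_nonneg _
      have := solNorm_nonneg w n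
      gcongr
    · rw [← hS]
      calc _ = √S * √S * (S ^ k / k.factorial) * ‖x‖ := by ring
        _ = _ := by rw [Real.mul_self_sqrt hS0]
  rw [← tendsto_add_atTop_iff_nat 1]
  have hlim : Tendsto (fun k : ℕ => |C| * S * ((|C| * S) ^ k / k.factorial)) atTop (𝓝 0) := by
    simpa using (FloorSemiring.tendsto_pow_div_factorial_atTop (|C| * S)).const_mul (|C| * S)
  refine squeeze_zero_norm (fun k => ?_) hlim
  rw [norm_mul, norm_pow, norm_norm, Real.norm_eq_abs]
  calc |C| ^ (k + 1) * ‖R ^ (k + 1)‖ ≤ |C| ^ (k + 1) * (S * (S ^ k / k.factorial)) := by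
        gcongr; exact hnorm k
    _ = _ := by ring

/-- Adding `P j * Q i` to the Volterra kernel yields the Green kernel `P (min i j) * Q (max i j)`,
which is real and symmetric. -/
theorem inner_add_rankOne_symm [CompleteSpace E] (v : HilbertBasis ℕ ℂ E)
    {R : E →L[ℂ] E} (hR : ∀ x, coeff v (R x) = volterra w (coeff v x)) {u q : E}
    (hu : coeff v u = fun n => (solP w n : ℂ)) (hq : coeff v q = fun n => (solQ w n : ℂ)) (x y : E) :
    ⟪R x + ⟪q, x⟫_ℂ • u, y⟫_ℂ = ⟪x, R y + ⟪q, y⟫_ℂ • u⟫_ℂ := by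
  set G : E →L[ℂ] E := R + (innerSL ℂ q).smulRight u with hG
  have hGv : ∀ i j, ⟪v j, G (v i)⟫_ℂ =
      ((if i < j then solQ w j * solP w i else solP w j * solQ w i : ℝ) : ℂ) := fun i j => by
    have h1 : coeff v (R (v i)) j = ((if i < j then wronskianKernel w j i else 0 : ℝ) : ℂ) := by
      rw [hR, coeff_self, volterra_apply]
      split_ifs with h <;> simp [Pi.single_apply, h]
    have h2 : ⟪q, v i⟫_ℂ = solQ w i := by
      rw [← inner_conj_symm, ← coeff_apply, hq, Complex.conj_ofReal]
    have h3 : ⟪v j, u⟫_ℂ = solP w j := congrFun hu j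
    have h4 : G (v i) = R (v i) + ⟪q, v i⟫_ℂ • u := rfl
    rw [h4, inner_add_right, inner_smul_right, ← coeff_apply, h1, h2, h3]
    split_ifs <;> push_cast [wronskianKernel] <;> ring
  have hadj : ContinuousLinearMap.adjoint G = G := by
    have hd : Dense (Submodule.span ℂ (Set.range v) : Set E) :=
      Submodule.dense_iff_topologicalClosure_eq_top.2 v.dense_span
    refine ContinuousLinearMap.ext_on hd ?_
    rintro _ ⟨i, rfl⟩
    refine coeff_injective v (funext fun j => ?_)
    rw [coeff_apply, coeff_apply, ContinuousLinearMap.adjoint_inner_right, ← inner_conj_symm,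
      hGv, hGv, Complex.conj_ofReal]
    norm_cast
    rcases lt_trichotomy i j with h | rfl | h
    · rw [if_pos h, if_neg h.not_gt, mul_comm]
    · rfl
    · rw [if_pos h, if_neg h.not_gt, mul_comm]
  change ⟪G x, y⟫_ℂ = ⟪x, G y⟫_ℂ
  rw [← ContinuousLinearMap.adjoint_inner_right, hadj]

/-- A Jacobi operator with vanishing diagonal, whose off-diagonal entries grow fast enough, is
chaotic on its maximal domain. -/
theorem isChaotic_maximalOp [CompleteSpace E] (v : HilbertBasis ℕ ℂ E) (hw : ∀ n, 0 < w n)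
    (hgrow : ∀ n : ℕ, (n + 4) * w n ^ 2 ≤ (n + 1) * w (n + 1) ^ 2) (hM : IsJacobi w M) :
    IsChaotic (maximalOp v M) := by
  have hρ := summable_solNorm_sq hw hgrow
  obtain ⟨u, hu⟩ := exists_coeff_eq v (a := fun n => (solP w n : ℂ)) (by
    simpa [solP] using summable_recSol_sq hw hgrow 1 0)
  obtain ⟨q, hq⟩ := exists_coeff_eq v (a := fun n => (solQ w n : ℂ)) (by
    simpa [solQ] using summable_recSol_sq hw hgrow 0 (1 / w 0))
  obtain ⟨R, hR⟩ := exists_clm_coeff_eq v (volterra w) hρ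
    (C := √(∑' n, solNorm w n ^ 2)) (by positivity) fun x n => by
      refine (norm_volterra_le w _ n).trans ?_
      gcongr
      · exact solNorm_nonneg w n
      · exact sum_mul_norm_coeff_le v hρ x _
  refine IsChaotic.of_quasinilpotent (R := R) (u := u) (q := q) ?_ (fun x y => ?_)
    (tendsto_pow_mul_norm_pow v hρ hR) (inner_add_rankOne_symm v hR hu hq)
  · rintro rfl
    have := congrFun hu 0
    simp [solP, recSol] at this
  · rw [mem_graph_maximalOp (coeff_injective v), Submodule.mem_span_singleton]
    have h1 : coeff v y = M (coeff v x) ↔ M (coeff v (x - R y)) = 0 := by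
      rw [map_sub, map_sub, hR, hM.apply_volterra hw, sub_eq_zero, eq_comm]
    rw [h1]
    constructor
    · intro h
      refine ⟨coeff v (x - R y) 0, coeff_injective v ?_⟩
      rw [map_smul, hu]
      exact (hM.eq_smul_solP hw h).symm
    · rintro ⟨c, hc⟩
      rw [← hc, map_smul, map_smul, hu, hM.apply_solP hw, smul_zero]

end Jacobi

/-! ### The monomials form an orthonormal basis -/

theorem inner_e (j k : ℕ) : ⟪e j, e k⟫_ℂ = ∫ z : ℂ, (Real.pi⁻¹ * Real.exp (-‖z‖ ^ 2)) •
    ⟪monomialFun j z, monomialFun k z⟫_ℂ := by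
  rw [L2.inner_def]
  have h1 : (fun z => ⟪e j z, e k z⟫_ℂ) =ᵐ[gaussian]
      fun z => ⟪monomialFun j z, monomialFun k z⟫_ℂ := by
    filter_upwards [(memLp_monomialFun j).coeFn_toLp, (memLp_monomialFun k).coeFn_toLp]
      with z hj hk
    rw [e, e, hj, hk]
  rw [integral_congr_ae h1, gaussian,
    integral_withDensity_eq_integral_toReal_smul (by fun_prop) (by simp)]
  refine integral_congr_ae (Eventually.of_forall fun z => ?_)
  have := Real.pi_pos
  simp only
  rw [ENNReal.toReal_ofReal (by positivity)]

theorem monomialFun_mul (k : ℕ) (c z : ℂ) : monomialFun k (c * z) = c ^ k * monomialFun k z := by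
  simp only [monomialFun, mul_pow, mul_div_assoc]

/-- Rotation by `π / (k - j)` preserves the measure and changes the sign of the integrand. -/
theorem inner_e_of_lt {j k : ℕ} (h : j < k) : ⟪e j, e k⟫_ℂ = 0 := by
  set θ : ℝ := Real.pi / (k - j) with hθ
  set c : Circle := Circle.exp θ with hc
  have hcc : (starRingEnd ℂ) (c : ℂ) ^ j * (c : ℂ) ^ k = -1 := by
    have h1 : (starRingEnd ℂ) (c : ℂ) * c = 1 := by
      rw [mul_comm, Complex.mul_conj, Circle.normSq_coe, Complex.ofReal_one]
    have h2 : (c : ℂ) ^ (k - j) = -1 := by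
      rw [hc, Circle.coe_exp, ← Complex.exp_nat_mul, ← Complex.exp_pi_mul_I, hθ]
      congr 1
      have h3 : (k : ℂ) - j ≠ 0 := by
        rw [sub_ne_zero]
        exact_mod_cast h.ne'
      push_cast [Nat.cast_sub h.le]
      field_simp
    rw [show k = j + (k - j) by omega, pow_add, ← mul_assoc, ← mul_pow, h1, one_pow, one_mul, h2]
  set F : ℂ → ℂ := fun z => (Real.pi⁻¹ * Real.exp (-‖z‖ ^ 2)) •
    ⟪monomialFun j z, monomialFun k z⟫_ℂ with hF
  have h1 : ∫ z, F (rotation c z) = ∫ z, F z :=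
    (rotation c).measurePreserving.integral_comp
      (rotation c).toHomeomorph.measurableEmbedding F
  have h2 : ∀ z, F (rotation c z) = -F z := fun z => by
    simp only [hF, rotation_apply, monomialFun_mul, norm_mul, Circle.norm_coe, one_mul,
      RCLike.inner_apply, map_mul, map_pow]
    rw [← smul_neg]
    congr 1
    linear_combination (starRingEnd ℂ) (monomialFun j z) * monomialFun k z * hcc
  simp only [h2, integral_neg] at h1
  rw [inner_e]
  exact self_eq_neg.1 h1.symm

theorem inner_e_self (k : ℕ) : ⟪e k, e k⟫_ℂ = 1 := by
  have h1 := Complex.integral_rpow_mul_exp_neg_rpow (p := 2) (q := (2 * k : ℕ)) (by norm_num)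
    (by have : (0 : ℝ) ≤ ((2 * k : ℕ) : ℝ) := by positivity
        linarith)
  have h2 : (((2 * k : ℕ) : ℝ) + 2) / 2 = k + 1 := by push_cast; ring
  rw [h2, Real.Gamma_nat_eq_factorial] at h1
  have hk : (0 : ℝ) < k.factorial := by positivity
  have h3 : ∀ z : ℂ, (Real.pi⁻¹ * Real.exp (-‖z‖ ^ 2)) • ⟪monomialFun k z, monomialFun k z⟫_ℂ =
      (((k.factorial : ℝ)⁻¹ * Real.pi⁻¹ *
        (‖z‖ ^ ((2 * k : ℕ) : ℝ) * Real.exp (-‖z‖ ^ (2 : ℝ))) : ℝ) : ℂ) := fun z => by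
    have h4 : ‖monomialFun k z‖ ^ 2 = (k.factorial : ℝ)⁻¹ * ‖z‖ ^ (2 * k) := by
      simp only [monomialFun, norm_div, norm_pow, Complex.norm_real]
      rw [div_pow, Real.norm_of_nonneg (Real.sqrt_nonneg _), Real.sq_sqrt hk.le]
      field_simp
      ring
    rw [inner_self_eq_norm_sq_to_K, Complex.real_smul, ← RCLike.ofReal_pow, h4,
      Real.rpow_natCast, Real.rpow_two]
    refine (Complex.ofReal_mul _ _).symm.trans (congrArg _ ?_)
    rw [Algebra.algebraMap_self_apply]
    ring
  have hpi := Real.pi_ne_zero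
  rw [inner_e]
  simp only [h3]
  rw [integral_complex_ofReal, integral_const_mul, h1, Complex.ofReal_eq_one]
  field_simp

theorem orthonormal_e : Orthonormal ℂ e := by
  rw [orthonormal_iff_ite]
  intro j k
  rcases lt_trichotomy j k with h | rfl | h
  · rw [if_neg h.ne, inner_e_of_lt h]
  · rw [if_pos rfl, inner_e_self]
  · rw [if_neg h.ne', ← inner_conj_symm, inner_e_of_lt h, map_zero]

theorem orthonormal_b (p : ℕ) : Orthonormal ℂ (b p) := by
  rw [orthonormal_iff_ite]
  intro j k
  have h := orthonormal_iff_ite.1 orthonormal_e (p + j) (p + k)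
  simp only [add_right_inj] at h
  exact h

theorem exists_hilbertBasis_b (p : ℕ) : ∃ v : HilbertBasis ℕ ℂ (bargmannSub p), ⇑v = b p := by
  refine ⟨HilbertBasis.mkOfOrthogonalEqBot (orthonormal_b p) ?_,
    HilbertBasis.coe_mkOfOrthogonalEqBot _ _⟩
  rw [Submodule.eq_bot_iff]
  intro x hx
  refine coeff_b_injective p ?_
  rw [map_zero]
  ext n
  exact (Submodule.mem_orthogonal _ _).1 hx _ (Submodule.subset_span ⟨n, rfl⟩)

/-! ### The weights -/

theorem weight_add (p m n : ℕ) :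
    weight p m (p + n) = √((p + n).factorial * (p + n + m).factorial : ℝ) / n.factorial := by
  rw [weight, Nat.add_sub_cancel_left]

theorem weight_add_pos (p m n : ℕ) : 0 < weight p m (p + n) := by
  rw [weight_add]
  positivity

theorem weight_add_growth {p m : ℕ} (h : 3 ≤ 2 * p + m) (n : ℕ) :
    (n + 4) * weight p m (p + n) ^ 2 ≤ (n + 1) * weight p m (p + (n + 1)) ^ 2 := by
  have h1 : weight p m (p + (n + 1)) ^ 2 * (n + 1) ^ 2 =
      ((p + n + 1) * (p + n + m + 1)) * weight p m (p + n) ^ 2 := by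
    rw [weight_add, weight_add, div_pow, div_pow, Real.sq_sqrt (by positivity),
      Real.sq_sqrt (by positivity), show p + (n + 1) = p + n + 1 by ring,
      show p + n + 1 + m = p + n + m + 1 by ring, Nat.factorial_succ (p + n),
      Nat.factorial_succ (p + n + m), Nat.factorial_succ n]
    push_cast
    field_simp
  -- The right side is `(n + 1) ^ 2 + (2p + m) (n + 1) + p (p + m)`, and `2p + m ≥ 3`.
  have h2 : ((n : ℝ) + 4) * (n + 1) ≤ (p + n + 1) * (p + n + m + 1) := by
    have h3 : (3 : ℝ) ≤ 2 * p + m := by exact_mod_cast h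
    have h4 : (0 : ℝ) ≤ p * (p + m) := by positivity
    nlinarith [mul_le_mul_of_nonneg_right h3 (show (0 : ℝ) ≤ n + 1 by positivity)]
  have h5 : (0 : ℝ) < n + 1 := by positivity
  refine le_of_mul_le_mul_right ?_ h5
  calc (n + 4) * weight p m (p + n) ^ 2 * (n + 1)
      = ((n + 4) * (n + 1)) * weight p m (p + n) ^ 2 := by ring
    _ ≤ ((p + n + 1) * (p + n + m + 1)) * weight p m (p + n) ^ 2 := by gcongr
    _ = _ := by rw [← h1]; ring

theorem isJacobi_backward_add_forward (p m : ℕ) :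
    IsJacobi (fun n => weight p m (p + n)) (backward p m + forward p m) :=
  ⟨fun _ => by simp [backward, forward], fun _ _ => rfl⟩

/-! ### The operator sum -/

theorem coeff_b_b (p i : ℕ) : coeff (b p) (b p i) = Pi.single i 1 := by
  obtain ⟨v, hv⟩ := exists_hilbertBasis_b p
  rw [← hv]
  exact coeff_self v i

theorem b_zero_mem_graph_shift (p m : ℕ) : (b p 0, 0) ∈ (shift p m).graph := by
  rw [shift, mem_graph_maximalOp (coeff_b_injective p), coeff_b_b]
  ext n
  simp [backward]

theorem b_succ_mem_graph_shift (p m i : ℕ) :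
    (b p (i + 1), (weight p m (p + i) : ℂ) • b p i) ∈ (shift p m).graph := by
  rw [shift, mem_graph_maximalOp (coeff_b_injective p), map_smul, coeff_b_b, coeff_b_b]
  ext n
  by_cases h : n = i
  · subst h; simp [backward]
  · simp [backward, h]

theorem dense_domain_shift (p m : ℕ) : Dense ((shift p m).domain : Set (bargmannSub p)) := by
  obtain ⟨v, hv⟩ := exists_hilbertBasis_b p
  have hd : Dense (Submodule.span ℂ (Set.range v) : Set (bargmannSub p)) :=
    Submodule.dense_iff_topologicalClosure_eq_top.2 v.dense_span
  refine hd.mono (Submodule.span_le.2 ?_)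
  rintro _ ⟨i, rfl⟩
  rw [hv]
  cases i with
  | zero => exact LinearPMap.mem_domain_of_mem_graph (b_zero_mem_graph_shift p m)
  | succ i => exact LinearPMap.mem_domain_of_mem_graph (b_succ_mem_graph_shift p m i)

theorem inner_adjoint_eq {E : Type*} [NormedAddCommGroup E] [InnerProductSpace ℂ E]
    [CompleteSpace E] {T : Op E} (hT : Dense (T.domain : Set E)) (x : T†.domain) {y z : E}
    (h : (y, z) ∈ T.graph) : ⟪y, T† x⟫_ℂ = ⟪z, (x : E)⟫_ℂ := by
  obtain ⟨y', rfl, rfl⟩ := T.mem_graph_iff.1 h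
  rw [← inner_conj_symm, LinearPMap.adjoint_isFormalAdjoint hT x y', inner_conj_symm]

/-- The basis vectors lie in the domain of the shift, so pairing with them reads off the
coefficients of the adjoint. -/
theorem coeff_shift_adjoint (p m : ℕ) (x : (shift p m)†.domain) :
    coeff (b p) ((shift p m)† x) = forward p m (coeff (b p) x) := by
  have key : ∀ y z, (y, z) ∈ (shift p m).graph →
      ⟪y, (shift p m)† x⟫_ℂ = ⟪z, (x : bargmannSub p)⟫_ℂ := fun y z h =>
    inner_adjoint_eq (dense_domain_shift p m) x h
  ext n
  cases n with
  | zero =>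
    refine (key _ _ (b_zero_mem_graph_shift p m)).trans ?_
    simp [forward]
  | succ n =>
    refine (key _ _ (b_succ_mem_graph_shift p m n)).trans ?_
    refine (inner_smul_left (b p n) (x : bargmannSub p) _).trans ?_
    rw [Complex.conj_ofReal]
    rfl

theorem shift_add_adjoint_le (p m : ℕ) : shift p m + (shift p m)† ≤ shiftSum p m := by
  refine LinearPMap.le_of_le_graph ?_
  rintro ⟨x, y⟩ h
  obtain ⟨⟨x, hx⟩, rfl, rfl⟩ := (LinearPMap.mem_graph_iff _).1 h
  rw [shiftSum, mem_graph_maximalOp (coeff_b_injective p), LinearPMap.add_apply, map_add,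
    coeff_shift_adjoint, LinearMap.add_apply]
  congr 1
  exact (mem_graph_maximalOp (coeff_b_injective p)).1
    (LinearPMap.mem_graph (shift p m) ⟨x, hx.1⟩)

end HeunBargmann

theorem theorem3p8 (p m : ℕ) (hm : 1 ≤ m) (hpm : 1 < (p : ℝ) + (m : ℝ) / 2) :
    HeunBargmann.shift p m + (HeunBargmann.shift p m)† ≤ HeunBargmann.shiftSum p m ∧
      HeunBargmann.IsChaotic (HeunBargmann.shiftSum p m) := by
  -- An integer above `2` is at least `3`, the constant the growth condition needs.
  have h3 : 3 ≤ 2 * p + m := by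
    have : (2 : ℝ) < ((2 * p + m : ℕ) : ℝ) := by push_cast; linarith
    exact_mod_cast this
  refine ⟨HeunBargmann.shift_add_adjoint_le p m, ?_⟩
  obtain ⟨v, hv⟩ := HeunBargmann.exists_hilbertBasis_b p
  rw [HeunBargmann.shiftSum, ← hv]
  exact HeunBargmann.isChaotic_maximalOp v (HeunBargmann.weight_add_pos p m)
    (HeunBargmann.weight_add_growth h3) (HeunBargmann.isJacobi_backward_add_forward p m)
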